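/- Let $q$ and $m$ be positive integers composed of the same primes, such that the exponent of each of these primes in $q$ is strictly greater than its exponent in $m$; call such a $q$ admissible for $m$. A digital set of cardinality $m$ in $\mathbb{Z}_q=\mathbb{Z}/q\mathbb{Z}$ is a set $A\subseteq\mathbb{Z}_q$ with $|A|=m$ that is a complete set of representatives of the cosets of the subgroup $m\mathbb{Z}_q$. Its frequency of carries is $$C_2(A)=\frac{|\{(a_1,a_2)\in A\times A:\ a_1+a_2\notin A\}|}{|A|^2}.$$ Let $p^\alpha$ be the largest prime power dividing $m$ ($p$ prime; $p^\alpha=1$ if $m=1$), let $\delta_m=1$ if $m$ is odd and $\delta_m=0$ if $m$ is even, and put $$\mu(m)=\begin{cases}\dfrac14 & \text{if } p^\alpha \text{ is even, i.e. } m>1 \text{ and } p=2,\\[2mm] \dfrac14\left(1-\dfrac1{p^{2\alpha}}-\dfrac2{p^\alpha}+\dfrac{2\delta_m}{m}\right)&\text{otherwise.}\end{cases}$$ Then every digital set $A\subseteq\mathbb{Z}_q$ with $|A|=m$ satisfies $C_2(A)\ge\mu(m)$. In particular, $$\lim_{m\to\infty}\ \min_{|A|=m}C_2(A)=\frac14 .$$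 This holds (and the minima exist) both when, for each $m$, the minimum is taken over all digital sets of cardinality $m$ in $\mathbb{Z}_q$ for all admissible $q$, and when it is taken over the digital sets of cardinality $m$ in $\mathbb{Z}_{q(m)}$ for any fixed choice of admissible moduli $q(m)$, one for each $m$. -/

import Mathlib

open Filter Topology

/-- `q` and `m` are positive integers composed of the same primes, and the exponent of each of
these primes in `q` is strictly greater than in `m`. -/
def Admissible (m q : ℕ) : Prop :=
  0 < m ∧ 0 < q ∧ q.primeFactors = m.primeFactors ∧
    ∀ p ∈ m.primeFactors, m.factorization p < q.factorization p

/-- `A ⊆ ℤ/q` is a digital set of cardinality `m`: it has `m` elements and is a complete set of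
representatives of the cosets of the subgroup `m · (ℤ/q)`. -/
def IsDigitalSet (m q : ℕ) (A : Finset (ZMod q)) : Prop :=
  A.card = m ∧
    ∀ x : ZMod q, ∃! a : ZMod q, a ∈ A ∧ x - a ∈ AddSubgroup.zmultiples (m : ZMod q)

/-- The frequency of carries `C₂(A) = |{(a₁, a₂) ∈ A × A : a₁ + a₂ ∉ A}| / |A|²`. -/
noncomputable def carryFreq {q : ℕ} (A : Finset (ZMod q)) : ℝ :=
  (((A ×ˢ A).filter (fun x => x.1 + x.2 ∉ A)).card : ℝ) / (A.card : ℝ) ^ 2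

/-- The largest prime power `p ^ α` dividing `m` (equal to `1` when `m = 1`). -/
noncomputable def maxPrimePower (m : ℕ) : ℕ :=
  sSup {n : ℕ | ∃ p k : ℕ, p.Prime ∧ n = p ^ k ∧ n ∣ m}

/-- `δ_m = 1` if `m` is odd and `δ_m = 0` if `m` is even. -/
def oddIndicator (m : ℕ) : ℝ := if Odd m then 1 else 0

/-- The lower bound `μ(m)`. With `p ^ α` the largest prime power dividing `m`, the prime `p` is `2`
exactly when `2 ∣ p ^ α` (for `m = 1` this power is `1` and the second formula is used). -/
noncomputable def carryBound (m : ℕ) : ℝ :=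
  if 2 ∣ maxPrimePower m then 1 / 4
  else (1 - 1 / (maxPrimePower m : ℝ) ^ 2 - 2 / (maxPrimePower m : ℝ)
    + oddIndicator m * 2 / (m : ℝ)) / 4

/-- The values `C₂(A)` for the digital sets `A ⊆ ℤ/q` with `|A| = m`, the modulus `q` being
fixed. -/
def carryFreqsMod (m q : ℕ) : Set ℝ :=
  {c | ∃ A : Finset (ZMod q), IsDigitalSet m q A ∧ c = carryFreq A}

/-- The values `C₂(A)` for the digital sets `A` with `|A| = m`, over all admissible moduli. -/
def carryFreqs (m : ℕ) : Set ℝ :=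
  {c | ∃ q : ℕ, Admissible m q ∧ c ∈ carryFreqsMod m q}

/-! For `g` in `ℤ/q` let `c g` count the `a ∈ A` with `a + g ∉ A`. Then `c` is subadditive, its
deficits `m - c g` sum to `m²`, and `c g = m` for nonzero `g ∈ K = m(ℤ/q)`. So for `i + j < m` the
level sets satisfy `L_i + L_j ⊆ L_(i+j)`, and `L_(i+j)` meets `K` only in `0`. Strictly larger
exponents in `q` make every nonzero cyclic subgroup meet `K` nontrivially, so
`card_add_card_le_of_inter_trivial` gives `|L_i| + |L_j| ≤ |L_(i+j)| + 1`. Since `∑ |L_t| = m²` over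
`t < m`, the low levels are small, and `layer_sum_bound` bounds `∑ |L_t ∩ A|`, which is `m²` minus
the number of carries. The result `C₂(A) ≥ (1 - δ_m/m²)/4` is at least as strong as `μ(m)`. Balanced
intervals of digits give `C₂ ≤ 1/4`, hence the limit. -/

/-- A Scherk-type addition theorem: if `K` meets every nontrivial cyclic subgroup nontrivially and
`X + Y` meets `K` only in `0`, then `|X + Y| ≥ |X| + |Y| - 1`. The set `Z` contains `X + Y`. -/
theorem card_add_card_le_of_inter_trivial {G : Type*} [AddCommGroup G] [Fintype G] [DecidableEq G]
    (K : AddSubgroup G) (hK : ∀ y : G, y ≠ 0 → ∃ n : ℕ, n • y ∈ K ∧ n • y ≠ 0)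
    (Z : Finset G) (hZ : ∀ z ∈ Z, z ∈ K → z = 0) :
    ∀ (n : ℕ) (X Y : Finset G), Y.card = n → 0 ∈ X → 0 ∈ Y →
      (∀ x ∈ X, ∀ y ∈ Y, x + y ∈ Z) → X.card + Y.card ≤ Z.card + 1 := by
  intro n
  induction n using Nat.strong_induction_on with
  | _ n ih =>
    intro X Y hn hX hY hXY
    by_cases h : ∀ e ∈ X, ∀ y ∈ Y, e + y ∈ X
    -- Stable case: `X` contains all multiples of each `y ∈ Y`, so a nonzero `y` would put a nonzero
    -- element of `K` into `Z`.
    · have hY0 : Y = {0} := by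
        refine Finset.eq_singleton_iff_unique_mem.2 ⟨hY, fun y hy => ?_⟩
        by_contra hne
        obtain ⟨k, hk, hk0⟩ := hK y hne
        have hmem : ∀ j : ℕ, j • y ∈ X := by
          intro j
          induction j with
          | zero => simpa using hX
          | succ j hj => rw [succ_nsmul]; exact h _ hj _ hy
        exact hk0 (hZ _ (by simpa using hXY _ (hmem k) 0 hY) hk)
      have hsub : X ⊆ Z := fun x hx => by simpa using hXY x hx 0 hY
      have := Finset.card_le_card hsub
      rw [hY0, Finset.card_singleton]
      omega
    · push Not at h
      obtain ⟨e, he, y, hy, hey⟩ := h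
      -- Transform by `e`: each `v` with `e + v ∉ X` leaves `Y`, and `e + v` joins `X`. The total
      -- size is kept, and sums stay in `Z` because `(e + u) + v = (e + v) + u`.
      set Y' := Y.filter (fun v => e + v ∈ X) with hY'
      set W := (Y.filter (fun v => e + v ∉ X)).image (fun v => e + v) with hW
      have hWcard : W.card = (Y.filter (fun v => e + v ∉ X)).card :=
        Finset.card_image_of_injective _ (add_right_injective e)
      have hsplit : Y'.card + (Y.filter (fun v => e + v ∉ X)).card = Y.card :=
        Finset.card_filter_add_card_filter_not _
      have hdisj : Disjoint X W := by
        rw [Finset.disjoint_right]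
        intro w hw hwX
        obtain ⟨v, hv, rfl⟩ := Finset.mem_image.1 hw
        exact (Finset.mem_filter.1 hv).2 hwX
      have hlt : Y'.card < n := by
        rw [← hn]
        exact Finset.card_lt_card (Finset.filter_ssubset.2 ⟨y, hy, hey⟩)
      have key := ih _ hlt (X ∪ W) Y' rfl (Finset.mem_union_left _ hX)
        (by simp [hY', hY, he]) (by
          intro x hx v hv
          obtain ⟨hvY, hvX⟩ := Finset.mem_filter.1 hv
          rcases Finset.mem_union.1 hx with hx | hx
          · exact hXY x hx v hvY
          · obtain ⟨u, hu, rfl⟩ := Finset.mem_image.1 hx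
            have := hXY _ hvX u (Finset.mem_filter.1 hu).1
            rwa [add_right_comm] at this)
      rw [Finset.card_union_of_disjoint hdisj] at key
      omega

/-- A layer sum of a sequence `s` that is superadditive up to `1`, truncated at `m`. -/
theorem layer_sum_bound (m : ℕ) (hm : 0 < m) (s d : ℕ → ℕ)
    (hsum : ∑ t ∈ Finset.range m, s t = m ^ 2)
    (hs : ∀ i j, i + j < m → s i + s j ≤ s (i + j) + 1)
    (hds : ∀ t, d t ≤ s t) (hdm : ∀ t, d t ≤ m) :
    4 * ∑ t ∈ Finset.range m, d t ≤ 3 * m ^ 2 + (if Odd m then 1 else 0) := by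
  have hs0 : s 0 ≤ 1 := by have := hs 0 0 (by simpa using hm); simp at this; omega
  -- The extra `s n` makes the induction close: the left side grows by `3 s n + s (n+1)`, which is
  -- at most `s (2n) + s (2n+1) + 2`.
  have dbl : ∀ n, 2 * n ≤ m →
      4 * ∑ t ∈ Finset.range n, s t + s n ≤ ∑ t ∈ Finset.range (2 * n), s t + 2 * n + 1 := by
    intro n
    induction n with
    | zero => intro _; simpa using hs0
    | succ n ih =>
      intro hn
      have h1 := ih (by omega)
      have h2 := hs n n (by omega)
      have h3 := hs n (n + 1) (by omega)
      rw [show 2 * (n + 1) = 2 * n + 1 + 1 by ring, Finset.sum_range_succ, Finset.sum_range_succ,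
        Finset.sum_range_succ]
      rw [show n + n = 2 * n by ring] at h2
      rw [show n + (n + 1) = 2 * n + 1 by ring] at h3
      omega
  have hdsum : ∀ n, ∑ t ∈ Finset.range n, d t ≤ ∑ t ∈ Finset.range n, s t :=
    fun n => Finset.sum_le_sum fun t _ => hds t
  have htail : ∀ n k, ∑ t ∈ Finset.range k, d (n + t) ≤ k * m := by
    intro n k
    calc _ ≤ ∑ _t ∈ Finset.range k, m := Finset.sum_le_sum fun t _ => hdm _
      _ = k * m := by simp
  rcases Nat.even_or_odd' m with ⟨k, rfl | rfl⟩
  · rw [if_neg (by simp)]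
    obtain ⟨n, rfl⟩ : ∃ n, k = n + 1 := ⟨k - 1, by omega⟩
    have h1 := dbl (n + 1) le_rfl
    have h2 := hdsum (n + 1)
    have h3 := htail (n + 2) n
    have h4 := hds (n + 1)
    have h5 := hdm (n + 1)
    rw [hsum, show (2 * (n + 1)) ^ 2 = 4 * (n + 1) ^ 2 by ring] at h1
    -- Four times the left side is at most four times the right side plus `1`; integrality removes
    -- that `1`, so even `m` has no error term.
    have h6 : ∑ t ∈ Finset.range (n + 1), d t + d (n + 1) ≤ (n + 1) ^ 2 + 2 * (n + 1) := by omega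
    rw [show 2 * (n + 1) = n + 2 + n by ring, Finset.sum_range_add, Finset.sum_range_succ]
    nlinarith
  · rw [if_pos ⟨k, rfl⟩]
    have h1 := dbl k (by omega)
    have h2 := hdsum k
    have h3 := htail (k + 1) k
    have h4 := hds k
    have h5 := hdm k
    have h6 := hs k k (by omega)
    rw [Finset.sum_range_succ] at hsum
    rw [← two_mul k] at h6
    rw [show 2 * k + 1 = k + 1 + k by ring, Finset.sum_range_add, Finset.sum_range_succ]
    nlinarith

/-! ### Carry counts and their level sets -/

/-- The number of elements of `A` carried out of `A` by adding `g`. -/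
def carryCount {q : ℕ} (A : Finset (ZMod q)) (g : ZMod q) : ℕ :=
  (A.filter (fun a => a + g ∉ A)).card

theorem carryCount_le {q : ℕ} (A : Finset (ZMod q)) (g : ZMod q) : carryCount A g ≤ A.card :=
  Finset.card_filter_le _ _

theorem carryCount_zero {q : ℕ} (A : Finset (ZMod q)) : carryCount A 0 = 0 := by
  simp [carryCount]

/-- If `a + g + h ∉ A`, then either `g` carries `a` out, or `a + g` is a digit that `h` carries out.
-/
theorem carryCount_add_le {q : ℕ} (A : Finset (ZMod q)) (g h : ZMod q) :
    carryCount A (g + h) ≤ carryCount A g + carryCount A h := by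
  unfold carryCount
  rw [← Finset.card_filter_add_card_filter_not
    (s := A.filter (fun a => a + (g + h) ∉ A)) (fun a => a + g ∉ A)]
  refine add_le_add (Finset.card_le_card fun a ha => ?_)
    (Finset.card_le_card_of_injOn (fun a => a + g) (fun a ha => ?_)
      (add_left_injective g).injOn)
  · simp only [Finset.mem_filter] at ha ⊢
    exact ⟨ha.1.1, ha.2⟩
  · simp only [Finset.coe_filter, Finset.mem_filter, Set.mem_ofPred_eq, not_not] at ha ⊢
    exact ⟨ha.2, by rw [add_assoc]; exact ha.1.2⟩

theorem sum_carryCount {q : ℕ} (A : Finset (ZMod q)) :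
    ((A ×ˢ A).filter (fun x => x.1 + x.2 ∉ A)).card = ∑ b ∈ A, carryCount A b := by
  simp only [carryCount, Finset.card_filter, Finset.sum_product]
  exact Finset.sum_comm

/-- Each pair `(a, b)` in `A × A` is joined by exactly one translation `g = b - a`. -/
theorem sum_card_sub_carryCount {q : ℕ} [NeZero q] (A : Finset (ZMod q)) :
    ∑ g : ZMod q, (A.card - carryCount A g) = A.card ^ 2 := by
  have h : ∀ g, A.card - carryCount A g = ∑ a ∈ A, if a + g ∈ A then 1 else 0 := by
    intro g
    have := Finset.card_filter_add_card_filter_not (s := A) (fun a => a + g ∈ A)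
    rw [← Finset.card_filter]
    unfold carryCount
    omega
  simp only [h]
  rw [Finset.sum_comm, sq, ← smul_eq_mul, ← Finset.sum_const]
  refine Finset.sum_congr rfl fun a _ => ?_
  rw [← Finset.card_filter]
  refine Finset.card_nbij' (fun g => a + g) (fun b => b - a) ?_ ?_ ?_ ?_ <;>
    simp [Set.MapsTo, Set.LeftInvOn]

theorem sum_card_layers {α : Type*} (s : Finset α) (f : α → ℕ) (m : ℕ) :
    ∑ t ∈ Finset.range m, (s.filter (fun g => f g ≤ t)).card = ∑ g ∈ s, (m - f g) := by
  simp only [Finset.card_filter]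
  rw [Finset.sum_comm]
  refine Finset.sum_congr rfl fun g _ => ?_
  rw [← Finset.card_filter]
  have : (Finset.range m).filter (fun t => f g ≤ t) = Finset.Ico (f g) m := by
    ext t; simp [and_comm]
  rw [this, Nat.card_Ico]

/-! ### Admissible moduli -/

theorem Admissible.mul_prime_dvd {m q p : ℕ} (h : Admissible m q) (hp : p.Prime) (hpq : p ∣ q) :
    m * p ∣ q := by
  obtain ⟨hm, hq, hpf, hlt⟩ := h
  rw [← Nat.factorization_le_iff_dvd (Nat.mul_ne_zero hm.ne' hp.ne_zero) hq.ne',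
    Nat.factorization_mul hm.ne' hp.ne_zero, hp.factorization]
  intro r
  have hr : m.factorization r ≤ q.factorization r := by
    by_cases hrm : r ∈ m.primeFactors
    · exact (hlt r hrm).le
    · rw [← Nat.support_factorization, Finsupp.notMem_support_iff] at hrm
      simp [hrm]
  by_cases hrp : p = r
  · subst hrp
    have := hlt p (hpf ▸ Nat.mem_primeFactors.2 ⟨hp, hpq, hq.ne'⟩)
    simpa using this
  · simpa [hrp] using hr

theorem Admissible.dvd {m q : ℕ} (h : Admissible m q) : m ∣ q := by
  by_cases hq : q = 1
  · have h1 : m = 1 := by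
      have := h.2.2.1
      rw [hq, Nat.primeFactors_one, eq_comm, Nat.primeFactors_eq_empty] at this
      have := h.1
      omega
    simp [h1]
  · obtain ⟨p, hp, hpq⟩ := Nat.exists_prime_and_dvd hq
    exact (Dvd.intro _ rfl).trans (h.mul_prime_dvd hp hpq)

/-- Every nonzero element of `ℤ/q` has a nonzero multiple in `m · (ℤ/q)`. -/
theorem Admissible.exists_nsmul_mem {m q : ℕ} (h : Admissible m q) (y : ZMod q) (hy : y ≠ 0) :
    ∃ n : ℕ, n • y ∈ AddSubgroup.zmultiples (m : ZMod q) ∧ n • y ≠ 0 := by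
  have : NeZero q := ⟨h.2.1.ne'⟩
  have ho : addOrderOf y ≠ 1 := by simpa using hy
  obtain ⟨p, hp, k, hk⟩ := Nat.exists_prime_and_dvd ho
  have hpq : p ∣ q := by
    have := addOrderOf_dvd_card (x := y)
    rw [ZMod.card] at this
    exact (Dvd.intro _ hk.symm).trans this
  obtain ⟨c, hc⟩ := h.mul_prime_dvd hp hpq
  have hpos : 0 < addOrderOf y := addOrderOf_pos y
  have hk0 : 0 < k := Nat.pos_of_ne_zero fun h0 => by rw [h0, mul_zero] at hk; omega
  -- With `k = ord(y)/p`, the multiple `k • y` has order `p`, and `mp ∣ q` forces it into `m(ℤ/q)`.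
  refine ⟨k, ?_, fun h0 => ?_⟩
  · have hz : ((p * k * y.val : ℕ) : ZMod q) = 0 := by
      have := addOrderOf_nsmul_eq_zero y
      rw [hk, nsmul_eq_mul] at this
      push_cast at this ⊢
      rwa [ZMod.natCast_zmod_val]
    rw [ZMod.natCast_eq_zero_iff] at hz
    have hd : p * (m * c) ∣ p * (k * y.val) := by
      rw [← mul_assoc p k, ← show q = p * (m * c) from hc.trans (by ring)]
      exact hz
    obtain ⟨e, he⟩ : m ∣ k * y.val :=
      (Dvd.intro _ rfl).trans (Nat.dvd_of_mul_dvd_mul_left hp.pos hd)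
    refine AddSubgroup.mem_zmultiples_iff.2 ⟨e, ?_⟩
    have : ((k * y.val : ℕ) : ZMod q) = ((m * e : ℕ) : ZMod q) := by rw [he]
    push_cast at this
    rw [ZMod.natCast_zmod_val] at this
    rw [nsmul_eq_mul, this, zsmul_eq_mul, mul_comm]
    simp
  · have := Nat.le_of_dvd hk0 (addOrderOf_dvd_iff_nsmul_eq_zero.2 h0)
    rw [hk] at this
    nlinarith [hp.two_le]

/-! ### The lower bound -/

theorem IsDigitalSet.four_mul_carries {m q : ℕ} {A : Finset (ZMod q)} (h : Admissible m q)
    (hA : IsDigitalSet m q A) :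
    m ^ 2 ≤ 4 * ((A ×ˢ A).filter (fun x => x.1 + x.2 ∉ A)).card + (if Odd m then 1 else 0) := by
  have : NeZero q := ⟨h.2.1.ne'⟩
  obtain ⟨hcard, hrep⟩ := hA
  -- Such a `g` moves each digit within its coset, where it is the only digit.
  have hcK : ∀ g ∈ AddSubgroup.zmultiples (m : ZMod q), g ≠ 0 → carryCount A g = m := by
    intro g hg hg0
    rw [← hcard, carryCount, Finset.filter_true_of_mem]
    intro a ha hag
    have := (hrep (a + g)).unique ⟨ha, by simpa using hg⟩ ⟨hag, by simp⟩
    exact hg0 (by simpa using this)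
  have key := layer_sum_bound m h.1
    (fun t => (Finset.univ.filter (fun g => carryCount A g ≤ t)).card)
    (fun t => (A.filter (fun g => carryCount A g ≤ t)).card)
    (by rw [sum_card_layers, ← hcard, sum_card_sub_carryCount])
    (by
      intro i j hij
      refine card_add_card_le_of_inter_trivial (AddSubgroup.zmultiples (m : ZMod q))
        h.exists_nsmul_mem _ ?_ _ _ _ rfl ?_ ?_ ?_
      · intro z hz hzK
        by_contra h0
        have := hcK z hzK h0
        have := (Finset.mem_filter.1 hz).2
        omega
      · simp [carryCount_zero]
      · simp [carryCount_zero]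
      · intro x hx y hy
        have hx := (Finset.mem_filter.1 hx).2
        have hy := (Finset.mem_filter.1 hy).2
        have := carryCount_add_le A x y
        exact Finset.mem_filter.2 ⟨Finset.mem_univ _, by omega⟩)
    (fun t => Finset.card_le_card (Finset.filter_subset_filter _ (Finset.subset_univ _)))
    (fun t => hcard ▸ Finset.card_filter_le _ _)
  rw [sum_card_layers] at key
  have hsum : ∑ g ∈ A, (m - carryCount A g) + ∑ g ∈ A, carryCount A g = m ^ 2 := by
    rw [← Finset.sum_add_distrib, Finset.sum_congr rfl (g := fun _ => m), Finset.sum_const, hcard,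
      smul_eq_mul, sq]
    intro g _
    have := carryCount_le A g
    omega
  rw [sum_carryCount]
  omega

theorem IsDigitalSet.le_carryFreq {m q : ℕ} {A : Finset (ZMod q)} (h : Admissible m q)
    (hA : IsDigitalSet m q A) : (1 - oddIndicator m / (m : ℝ) ^ 2) / 4 ≤ carryFreq A := by
  have hm : (0 : ℝ) < m := by exact_mod_cast h.1
  have key : (m : ℝ) ^ 2 ≤
      4 * (((A ×ˢ A).filter (fun x => x.1 + x.2 ∉ A)).card : ℝ) + oddIndicator m := by
    have := hA.four_mul_carries h
    unfold oddIndicator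
    split_ifs at this ⊢ <;> exact_mod_cast this
  rw [carryFreq, hA.1, le_div_iff₀ (by positivity)]
  have : (1 - oddIndicator m / (m : ℝ) ^ 2) / 4 * (m : ℝ) ^ 2
      = ((m : ℝ) ^ 2 - oddIndicator m) / 4 := by
    field_simp
  linarith

theorem maxPrimePower_spec {m : ℕ} (hm : 0 < m) :
    0 < maxPrimePower m ∧ maxPrimePower m ∣ m := by
  have hmem : maxPrimePower m ∈ {n : ℕ | ∃ p k : ℕ, p.Prime ∧ n = p ^ k ∧ n ∣ m} :=
    Nat.sSup_mem ⟨1, 2, 0, Nat.prime_two, by simp, one_dvd _⟩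
      ⟨m, fun n ⟨_, _, _, _, hn⟩ => Nat.le_of_dvd hm hn⟩
  obtain ⟨p, k, hp, hn, hd⟩ := hmem
  exact ⟨Nat.pos_of_dvd_of_pos hd hm, hd⟩

theorem carryBound_le {m : ℕ} (hm : 0 < m) :
    carryBound m ≤ (1 - oddIndicator m / (m : ℝ) ^ 2) / 4 := by
  obtain ⟨hP, hPm⟩ := maxPrimePower_spec hm
  have hP' : (0 : ℝ) < maxPrimePower m := by exact_mod_cast hP
  have hm' : (0 : ℝ) < m := by exact_mod_cast hm
  have hle : (maxPrimePower m : ℝ) ≤ m := by exact_mod_cast Nat.le_of_dvd hm hPm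
  have hinv : 1 / (m : ℝ) ≤ 1 / (maxPrimePower m : ℝ) := one_div_le_one_div_of_le hP' hle
  have hpos : 0 < 1 / (m : ℝ) := by positivity
  unfold carryBound oddIndicator
  by_cases hodd : Odd m
  · rw [if_neg (fun h2 => Nat.not_even_iff_odd.2 hodd (even_iff_two_dvd.2 (h2.trans hPm))),
      if_pos hodd]
    have e1 : 1 / (maxPrimePower m : ℝ) ^ 2 = (1 / (maxPrimePower m : ℝ)) ^ 2 := by
      rw [one_div_pow]
    have e2 : 2 / (maxPrimePower m : ℝ) = 2 * (1 / (maxPrimePower m : ℝ)) := by ring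
    have e3 : 1 * 2 / (m : ℝ) = 2 * (1 / (m : ℝ)) := by ring
    have e4 : 1 / (m : ℝ) ^ 2 = (1 / (m : ℝ)) ^ 2 := by rw [one_div_pow]
    rw [e1, e2, e3, e4]
    -- With `x = 1/m ≤ y = 1/p^α`, this is `(1 + x)² ≤ (1 + y)²`.
    nlinarith
  · rw [if_neg hodd]
    split_ifs
    · simp
    · have : 0 ≤ 1 / (maxPrimePower m : ℝ) ^ 2 := by positivity
      have : 0 ≤ 2 / (maxPrimePower m : ℝ) := by positivity
      simp only [zero_mul, zero_div]
      linarith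

/-! ### Interval digit sets and the upper bound -/

/-- Integers whose difference lies in `m · (ℤ/q)` are congruent modulo the divisor `m` of `q`. -/
theorem dvd_sub_of_mem_zmultiples {m q : ℕ} (hmq : m ∣ q) {i j : ℤ}
    (h : (i : ZMod q) - j ∈ AddSubgroup.zmultiples (m : ZMod q)) : (m : ℤ) ∣ i - j := by
  obtain ⟨n, hn⟩ := AddSubgroup.mem_zmultiples_iff.1 h
  have : ((n * m - (i - j) : ℤ) : ZMod q) = 0 := by
    push_cast
    rw [← hn, zsmul_eq_mul, sub_self]
  rw [ZMod.intCast_zmod_eq_zero_iff_dvd] at this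
  have h1 : (m : ℤ) ∣ n * m - (i - j) := (Int.natCast_dvd_natCast.2 hmq).trans this
  exact (dvd_sub_right (Dvd.intro_left n rfl)).1 h1

/-- The digits `-k, …, l` in `ℤ/q`. -/
noncomputable def intervalDigits (q k l : ℕ) : Finset (ZMod q) :=
  (Finset.Icc (-(k : ℤ)) l).image (Int.cast : ℤ → ZMod q)

theorem isDigitalSet_intervalDigits {q k l : ℕ} (hq : k + l + 1 ∣ q) :
    IsDigitalSet (k + l + 1) q (intervalDigits q k l) := by
  have huniq : ∀ i ∈ Finset.Icc (-(k : ℤ)) l, ∀ j ∈ Finset.Icc (-(k : ℤ)) l,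
      ((k + l + 1 : ℕ) : ℤ) ∣ i - j → i = j := by
    intro i hi j hj hd
    rw [Finset.mem_Icc] at hi hj
    have := Int.eq_zero_of_abs_lt_dvd hd (by rw [abs_lt]; push_cast; omega)
    omega
  constructor
  · rw [intervalDigits, Finset.card_image_of_injOn, Int.card_Icc]
    · omega
    · intro i hi j hj hij
      refine huniq i (by simpa using hi) j (by simpa using hj) (dvd_sub_of_mem_zmultiples hq ?_)
      rw [hij, sub_self]
      exact zero_mem _
  · intro x
    obtain ⟨n, rfl⟩ := ZMod.intCast_surjective x
    have hpos : (0 : ℤ) < ((k + l + 1 : ℕ) : ℤ) := by push_cast; omega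
    have h0 := Int.emod_nonneg (n + k) hpos.ne'
    have h1 := Int.emod_lt_of_pos (n + k) hpos
    have h2 := Int.emod_add_mul_ediv (n + k) ((k + l + 1 : ℕ) : ℤ)
    have hmem : (n + k) % ((k + l + 1 : ℕ) : ℤ) - k ∈ Finset.Icc (-(k : ℤ)) l := by
      rw [Finset.mem_Icc]
      push_cast at h0 h1 ⊢
      omega
    have hdiff : (n : ZMod q) - (((n + k) % ((k + l + 1 : ℕ) : ℤ) - k : ℤ) : ZMod q) ∈
        AddSubgroup.zmultiples ((k + l + 1 : ℕ) : ZMod q) := by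
      refine AddSubgroup.mem_zmultiples_iff.2 ⟨(n + k) / ((k + l + 1 : ℕ) : ℤ), ?_⟩
      rw [zsmul_eq_mul, ← Int.cast_natCast (R := ZMod q) (k + l + 1), ← Int.cast_mul,
        ← Int.cast_sub]
      congr 1
      linarith
    refine ⟨_, ⟨Finset.mem_image_of_mem _ hmem, hdiff⟩, ?_⟩
    rintro y ⟨hy, hyd⟩
    obtain ⟨j, hj, rfl⟩ := Finset.mem_image.1 hy
    congr 1
    refine huniq j hj _ hmem (dvd_sub_of_mem_zmultiples hq ?_)
    have := sub_mem hdiff hyd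
    rwa [sub_sub_sub_cancel_left] at this

theorem card_filter_add_notMem_Icc (k l : ℕ) (j : ℤ) :
    ((Finset.Icc (-(k : ℤ)) l).filter (fun i => i + j ∉ Finset.Icc (-(k : ℤ)) l)).card
      ≤ j.natAbs := by
  rcases le_total 0 j with hj | hj
  · calc _ ≤ (Finset.Ioc ((l : ℤ) - j) l).card := Finset.card_le_card fun i hi => by
          simp only [Finset.mem_filter, Finset.mem_Icc, Finset.mem_Ioc] at hi ⊢
          omega
      _ ≤ j.natAbs := by rw [Int.card_Ioc]; omega
  · calc _ ≤ (Finset.Ico (-(k : ℤ)) (-k - j)).card := Finset.card_le_card fun i hi => by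
          simp only [Finset.mem_filter, Finset.mem_Icc, Finset.mem_Ico] at hi ⊢
          omega
      _ ≤ j.natAbs := by rw [Int.card_Ico]; omega

theorem two_mul_sum_natAbs_Icc (k l : ℕ) :
    2 * ∑ j ∈ Finset.Icc (-(k : ℤ)) l, j.natAbs = k * (k + 1) + l * (l + 1) := by
  induction k with
  | zero =>
    induction l with
    | zero => simp
    | succ l ih =>
      have : Finset.Icc (-((0 : ℕ) : ℤ)) ((l + 1 : ℕ) : ℤ)
          = insert ((l + 1 : ℕ) : ℤ) (Finset.Icc (-((0 : ℕ) : ℤ)) l) := by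
        ext i; simp only [Finset.mem_insert, Finset.mem_Icc]; push_cast; omega
      rw [this, Finset.sum_insert (by simp), mul_add, ih, Int.natAbs_natCast]
      ring
  | succ k ih =>
    have : Finset.Icc (-((k + 1 : ℕ) : ℤ)) (l : ℤ)
        = insert (-((k + 1 : ℕ) : ℤ)) (Finset.Icc (-(k : ℤ)) l) := by
      ext i; simp only [Finset.mem_insert, Finset.mem_Icc]; push_cast; omega
    rw [this, Finset.sum_insert (by simp), mul_add, ih, Int.natAbs_neg, Int.natAbs_natCast]
    ring

theorem two_mul_carries_intervalDigits (q k l : ℕ) :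
    2 * ((intervalDigits q k l ×ˢ intervalDigits q k l).filter
      (fun x => x.1 + x.2 ∉ intervalDigits q k l)).card ≤ k * (k + 1) + l * (l + 1) := by
  rw [← two_mul_sum_natAbs_Icc]
  refine Nat.mul_le_mul_left 2 ?_
  set I := Finset.Icc (-(k : ℤ)) l with hI
  -- Only an inequality: a sum outside `I` may still reduce to a digit modulo `q`.
  calc _ ≤ (((I ×ˢ I).filter (fun x => x.1 + x.2 ∉ I)).image
        (fun x => ((x.1 : ZMod q), (x.2 : ZMod q)))).card := by
        refine Finset.card_le_card fun x hx => ?_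
        obtain ⟨hx, hn⟩ := Finset.mem_filter.1 hx
        obtain ⟨h1, h2⟩ := Finset.mem_product.1 hx
        obtain ⟨i, hi, hi'⟩ := Finset.mem_image.1 h1
        obtain ⟨j, hj, hj'⟩ := Finset.mem_image.1 h2
        refine Finset.mem_image.2 ⟨(i, j), Finset.mem_filter.2
          ⟨Finset.mem_product.2 ⟨hi, hj⟩, fun hij => hn ?_⟩, by simp [hi', hj']⟩
        rw [← hi', ← hj', ← Int.cast_add]
        exact Finset.mem_image_of_mem _ hij
    _ ≤ ((I ×ˢ I).filter (fun x => x.1 + x.2 ∉ I)).card := Finset.card_image_le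
    _ = ∑ j ∈ I, (I.filter (fun i => i + j ∉ I)).card := by
        simp only [Finset.card_filter, Finset.sum_product]
        exact Finset.sum_comm
    _ ≤ _ := Finset.sum_le_sum fun j _ => card_filter_add_notMem_Icc k l j

theorem exists_isDigitalSet_carryFreq_le {m q : ℕ} (h : Admissible m q) :
    ∃ A : Finset (ZMod q), IsDigitalSet m q A ∧ carryFreq A ≤ 1 / 4 := by
  obtain ⟨k, l, rfl, hkl⟩ : ∃ k l : ℕ, m = k + l + 1 ∧ (l = k ∨ l = k + 1) := by
    have := h.1
    exact ⟨(m - 1) / 2, m - 1 - (m - 1) / 2, by omega, by omega⟩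
  have hA := isDigitalSet_intervalDigits (k := k) (l := l) h.dvd
  refine ⟨_, hA, ?_⟩
  have hc := two_mul_carries_intervalDigits q k l
  have h4 : 4 * ((intervalDigits q k l ×ˢ intervalDigits q k l).filter
      (fun x => x.1 + x.2 ∉ intervalDigits q k l)).card ≤ (k + l + 1) ^ 2 := by
    -- The carries number at most `k(k+1)` when `m = 2k+1` and `(k+1)²` when `m = 2k+2`.
    rcases hkl with rfl | rfl <;> nlinarith
  rw [carryFreq, hA.1, div_le_iff₀ (by positivity)]
  have h4' : (4 : ℝ) * ((intervalDigits q k l ×ˢ intervalDigits q k l).filter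
      (fun x => x.1 + x.2 ∉ intervalDigits q k l)).card ≤ ((k + l + 1 : ℕ) : ℝ) ^ 2 := by
    exact_mod_cast h4
  linarith

/-! ### Existence of the minima and the limit -/

theorem exists_admissible {m : ℕ} (hm : 0 < m) : ∃ q, Admissible m q := by
  refine ⟨m ^ 2, hm, by positivity, Nat.primeFactors_pow m two_ne_zero, fun p hp => ?_⟩
  have : 0 < m.factorization p :=
    Nat.pos_of_ne_zero (by rwa [← Nat.support_factorization, Finsupp.mem_support_iff] at hp)
  rw [Nat.factorization_pow]
  simp
  omega

/-- All frequencies are `n/m²` with `n ≤ m²`, whatever `q` is, so minima exist even over infinitely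
many moduli. -/
theorem finite_carryFreqs_union (m : ℕ) :
    {c : ℝ | ∃ (q : ℕ) (A : Finset (ZMod q)), A.card = m ∧ c = carryFreq A}.Finite := by
  refine ((Set.finite_Iic (m * m)).image (fun n : ℕ => (n : ℝ) / (m : ℝ) ^ 2)).subset ?_
  rintro c ⟨q, A, hA, rfl⟩
  refine ⟨((A ×ˢ A).filter (fun x => x.1 + x.2 ∉ A)).card, ?_, ?_⟩
  · rw [Set.mem_Iic, ← hA, ← Finset.card_product]
    exact Finset.card_filter_le _ _
  · rw [carryFreq, hA]

theorem isLeast_sInf_of_finite {s : Set ℝ} (hs : s.Finite) (hne : s.Nonempty) :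
    IsLeast s (sInf s) :=
  ⟨hne.csInf_mem hs, fun _ hx => csInf_le hs.bddBelow hx⟩

theorem isLeast_carryFreqsMod {m q : ℕ} (h : Admissible m q) :
    IsLeast (carryFreqsMod m q) (sInf (carryFreqsMod m q)) := by
  obtain ⟨A, hA, _⟩ := exists_isDigitalSet_carryFreq_le h
  refine isLeast_sInf_of_finite ((finite_carryFreqs_union m).subset ?_) ⟨_, A, hA, rfl⟩
  rintro c ⟨B, hB, rfl⟩
  exact ⟨q, B, hB.1, rfl⟩

theorem isLeast_carryFreqs {m : ℕ} (hm : 0 < m) :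
    IsLeast (carryFreqs m) (sInf (carryFreqs m)) := by
  obtain ⟨q, h⟩ := exists_admissible hm
  obtain ⟨A, hA, _⟩ := exists_isDigitalSet_carryFreq_le h
  refine isLeast_sInf_of_finite ((finite_carryFreqs_union m).subset ?_) ⟨_, q, h, A, hA, rfl⟩
  rintro c ⟨r, _, B, hB, rfl⟩
  exact ⟨r, B, hB.1, rfl⟩

theorem one_sub_inv_sq_le_carryFreq {m q : ℕ} {A : Finset (ZMod q)} (h : Admissible m q)
    (hA : IsDigitalSet m q A) : (1 - 1 / (m : ℝ) ^ 2) / 4 ≤ carryFreq A := by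
  refine le_trans ?_ (hA.le_carryFreq h)
  have : oddIndicator m ≤ 1 := by unfold oddIndicator; split_ifs <;> norm_num
  gcongr

theorem tendsto_one_sub_inv_sq :
    Tendsto (fun m : ℕ => (1 - 1 / (m : ℝ) ^ 2) / 4) atTop (𝓝 (1 / 4)) := by
  have h : Tendsto (fun m : ℕ => 1 / (m : ℝ) ^ 2) atTop (𝓝 0) :=
    tendsto_const_nhds.div_atTop
      ((tendsto_pow_atTop two_ne_zero).comp tendsto_natCast_atTop_atTop)
  simpa using (h.const_sub 1).div_const 4

theorem theorem1 :
    (∀ (m q : ℕ) (A : Finset (ZMod q)), Admissible m q → IsDigitalSet m q A →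
      carryBound m ≤ carryFreq A) ∧
    -- the limit of the minimum over all digital sets of cardinality `m`, in all admissible `ℤ/q`
    ((∀ m : ℕ, 0 < m → IsLeast (carryFreqs m) (sInf (carryFreqs m))) ∧
      Tendsto (fun m : ℕ => sInf (carryFreqs m)) atTop (𝓝 (1 / 4))) ∧
    -- the limit of the minimum over the digital sets of cardinality `m` in one admissible `ℤ/q`
    ((∀ m q : ℕ, Admissible m q → IsLeast (carryFreqsMod m q) (sInf (carryFreqsMod m q))) ∧
      ∀ q : ℕ → ℕ, (∀ᶠ m in atTop, Admissible m (q m)) →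
        Tendsto (fun m : ℕ => sInf (carryFreqsMod m (q m))) atTop (𝓝 (1 / 4))) := by

  refine ⟨fun m q A h hA => (carryBound_le h.1).trans (hA.le_carryFreq h),
    ⟨fun m hm => isLeast_carryFreqs hm, ?_⟩, fun m q h => isLeast_carryFreqsMod h, ?_⟩
  · refine tendsto_of_tendsto_of_tendsto_of_le_of_le' tendsto_one_sub_inv_sq tendsto_const_nhds
      ?_ ?_
    · filter_upwards [eventually_gt_atTop 0] with m hm
      obtain ⟨q, h, A, hA, hc⟩ := (isLeast_carryFreqs hm).1
      rw [hc]
      exact one_sub_inv_sq_le_carryFreq h hA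
    · filter_upwards [eventually_gt_atTop 0] with m hm
      obtain ⟨q, h⟩ := exists_admissible hm
      obtain ⟨A, hA, hc⟩ := exists_isDigitalSet_carryFreq_le h
      exact ((isLeast_carryFreqs hm).2 ⟨q, h, A, hA, rfl⟩).trans hc
  · intro q hq
    refine tendsto_of_tendsto_of_tendsto_of_le_of_le' tendsto_one_sub_inv_sq tendsto_const_nhds
      ?_ ?_
    · filter_upwards [hq] with m h
      obtain ⟨A, hA, hc⟩ := (isLeast_carryFreqsMod h).1
      rw [hc]
      exact one_sub_inv_sq_le_carryFreq h hA
    · filter_upwards [hq] with m h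
      obtain ⟨A, hA, hc⟩ := exists_isDigitalSet_carryFreq_le h
      exact ((isLeast_carryFreqsMod h).2 ⟨A, hA, rfl⟩).trans hc
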